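/- **Setting.** Let $I$ be a finite index set. An *E-generalized Cartan matrix* (E-GCM) is a real matrix $A=(a_{ij})_{i,j\in I}$ with $a_{ii}=2$ for all $i$, with $a_{ij}\le 0$ for $i\ne j$, with $a_{ij}\neq 0 \Rightarrow a_{ji}\ne 0$, and such that for $i\neq j$ either $a_{ij}a_{ji}\ge 4$ or $a_{ij}a_{ji}=4\cos^2(\pi/k_{ij})$ for some integer $k_{ij}\ge 2$. For $i\ne j$ put $m_{ij}=k_{ij}$ in the second case and $m_{ij}=\infty$ in the first. Its graph $\Gamma$ has nodes $\gamma_i$ $(i\in I)$, with an edge between distinct $\gamma_i,\gamma_j$ whenever $a_{ij}\neq 0$. Let $W$ be the Coxeter group with generators $s_i$ $(i\in I)$ and relations $s_i^2=1$ and $(s_is_j)^{m_{ij}}=1$ for $i\neq j$ (no relation if $m_{ij}=\infty$). Let $V$ be the real vector space with basis $(\alpha_i)_{i\in I}$, let $B$ be the bilinear form with $B(\alpha_i,\alpha_j)=\frac12 a_{ij}$, and let $W$ act linearly on $V$ by $s_i.v=v-2B(\alpha_i,v)\alpha_i$. Put $\Phi=\{w.\alpha_i : w\in W,\ i\in I\}$,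 let $\Phi^+$ be the set of roots in $\Phi$ all of whose coordinates in the basis $(\alpha_i)$ are nonnegative, and for $\alpha\in\Phi$ let $\mathfrak S(\alpha)=\{K\alpha : K\in\mathbb R\}\cap\Phi^+$. Distinct nodes $\gamma_i,\gamma_j$ are *odd-neighborly* if $m_{ij}$ is finite and odd; they form an *odd asymmetry* if moreover $a_{ij}\neq a_{ji}$. An *ON-path* is a finite sequence of nodes (possibly a single node) in which consecutive nodes are odd-neighborly. An *ON-connected component* $(\Gamma',A')$ is the subgraph, with the corresponding submatrix $A'$ of $A$, on a maximal set $\{\gamma_x\}_{x\in J}$ of nodes that can be pairwise joined by ON-paths. **Corollary 3.7.** Let $A$ be an E-GCM with graph $\Gamma$. 1. $|\mathfrak S(\alpha)|=1$ for all $\alpha\in\Phi$ if and only if $(\Gamma,A)$ has no odd asymmetries. 2. Let $(\Gamma',A')$ be any ON-connected component of $(\Gamma,A)$, with node index set $J$. Then the following are equivalent: (a) $|\mathfrak S(w.\alpha_x)|=1$ for some $x\in J$ and some $w\in W$; (b) $|\mathfrak S(w.\alpha_x)|=1$ for all $x\in J$ and all $w\in W$; (c) $(\Gamma',A')$ has no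 odd asymmetries. 3. In particular, suppose that all entries of $A$ are integers (so $A$ is a generalized Cartan matrix). Then for $\alpha\in\Phi$ and $K\in\mathbb R$ we have $K\alpha\in\Phi$ if and only if $K=\pm1$. The same holds for Kac–Moody real roots: let $\mathfrak h$ be a real vector space of dimension $|I|+\dim\ker A$ with linearly independent $\alpha_i^\vee\in\mathfrak h$ and linearly independent $\alpha_i\in\mathfrak h^*$ $(i\in I)$ such that $\alpha_j(\alpha_i^\vee)=a_{ij}$, and let the real roots be the images of the $\alpha_i$ under the group generated by the reflections $v\mapsto v-v(\alpha_i^\vee)\alpha_i$ of $\mathfrak h^*$. If $\alpha$ is a real root and $K\in\mathbb R$, then $K\alpha$ is a real root if and only if $K=\pm1$. -/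

import Mathlib

/-- An E-generalized Cartan matrix: a real square matrix with `2` on the diagonal, nonpositive
entries off the diagonal, symmetric zero pattern, and with `a_ij a_ji` (for `i ≠ j`) either at
least `4` or equal to `4 cos² (π / k)` for some integer `k ≥ 2`. -/
structure IsEGCM {ι : Type*} (A : Matrix ι ι ℝ) : Prop where
  diag : ∀ i, A i i = 2
  nonpos : ∀ i j, i ≠ j → A i j ≤ 0
  ne_zero : ∀ i j, A i j ≠ 0 → A j i ≠ 0
  prod : ∀ i j, i ≠ j →
    4 ≤ A i j * A j i ∨ ∃ k : ℕ, 2 ≤ k ∧ A i j * A j i = 4 * Real.cos (Real.pi / k) ^ 2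

namespace EGCM

open Classical in
/-- The integer `k ≥ 2` with `c = 4 cos² (π / k)`, and `0` (standing for `∞`) if there is none,
in particular if `c ≥ 4`. -/
noncomputable def bondOrder (c : ℝ) : ℕ :=
  if h : ∃ k : ℕ, 2 ≤ k ∧ c = 4 * Real.cos (Real.pi / k) ^ 2 then Nat.find h else 0

theorem bondOrder_ne_one (c : ℝ) : bondOrder c ≠ 1 := by
  classical
  unfold bondOrder
  split_ifs with h
  · have := (Nat.find_spec h).1
    omega
  · simp

theorem bondOrder_spec {c : ℝ} (h : bondOrder c ≠ 0) :
    2 ≤ bondOrder c ∧ c = 4 * Real.cos (Real.pi / bondOrder c) ^ 2 := by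
  classical
  unfold bondOrder at *
  split_ifs at h ⊢ with h'
  · exact Nat.find_spec h'
  · exact absurd rfl h

section Matrix

variable {ι : Type*} [DecidableEq ι]

/-- The Coxeter matrix `(m_ij)` attached to `A`, with Mathlib's convention that the entry `0`
means `m_ij = ∞`. -/
noncomputable def coxeterMatrix (A : Matrix ι ι ℝ) : CoxeterMatrix ι where
  M := Matrix.of fun i j => if i = j then 1 else bondOrder (A i j * A j i)
  isSymm := by
    ext i j
    simp only [Matrix.transpose_apply, Matrix.of_apply, eq_comm (a := j) (b := i), mul_comm]
  diagonal i := by simp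
  off_diagonal i j h := by simpa [h] using bondOrder_ne_one _

/-- The Coxeter group `W(Γ, A)`. -/
abbrev W (A : Matrix ι ι ℝ) : Type _ := (coxeterMatrix A).Group

/-- Nodes `i` and `j` are odd-neighborly: they are distinct and `m_ij` is (finite and) odd. -/
def OddNeighbors (A : Matrix ι ι ℝ) (i j : ι) : Prop :=
  i ≠ j ∧ Odd (coxeterMatrix A i j)

/-- The graph on the nodes whose edges join odd-neighborly nodes: its walks are the ON-paths and
its connected components are the node sets of the ON-connected components. -/
def onGraph (A : Matrix ι ι ℝ) : SimpleGraph ι where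
  Adj i j := OddNeighbors A i j
  symm := ⟨fun i j h => ⟨h.1.symm, by rw [CoxeterMatrix.symmetric]; exact h.2⟩⟩
  loopless := ⟨fun _ h => h.1 rfl⟩

/-- Some pair of nodes forms an odd asymmetry: `m_ij` is odd and `a_ij ≠ a_ji`. -/
def HasOddAsymmetry (A : Matrix ι ι ℝ) : Prop :=
  ∃ i j, OddNeighbors A i j ∧ A i j ≠ A j i

/-- The submatrix `A'` belonging to an ON-connected component `(Γ', A')`. -/
def componentMatrix (A : Matrix ι ι ℝ) (C : (onGraph A).ConnectedComponent) :
    Matrix C.supp C.supp ℝ :=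
  A.submatrix (fun x => (x : ι)) (fun x => (x : ι))

end Matrix

section Representation

variable {ι : Type*} [Fintype ι] [DecidableEq ι] {A : Matrix ι ι ℝ}

/-- The simple root `α_i`, a standard basis vector of `V = ℝ^ι`. -/
def simpleRoot (i : ι) : ι → ℝ := Pi.single i 1

/-- The bilinear form on `V` with `B (α_i, α_j) = a_ij / 2`. -/
noncomputable def form (A : Matrix ι ι ℝ) : LinearMap.BilinForm ℝ (ι → ℝ) :=
  Matrix.toBilin' ((1 / 2 : ℝ) • A)

theorem form_simpleRoot (A : Matrix ι ι ℝ) (i j : ι) :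
    form A (simpleRoot i) (simpleRoot j) = A i j / 2 := by
  simp [form, simpleRoot, Matrix.toBilin'_single]
  ring

theorem two_form_self (hA : IsEGCM A) (i : ι) :
    ((2 : ℝ) • form A (simpleRoot i)) (simpleRoot i) = 2 := by
  simp [form_simpleRoot, hA.diag]

/-- `S_i (v) = v - 2 B (α_i, v) α_i`. -/
noncomputable def simpleReflection (hA : IsEGCM A) (i : ι) : (ι → ℝ) ≃ₗ[ℝ] (ι → ℝ) :=
  Module.reflection (two_form_self hA i)

theorem simpleReflection_apply (hA : IsEGCM A) (i : ι) (v : ι → ℝ) :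
    simpleReflection hA i v = v - (2 * form A (simpleRoot i) v) • simpleRoot i := by
  simp [simpleReflection, Module.reflection_apply]

/-- The operators `S_i` satisfy the defining relations of the Coxeter group. -/
theorem isLiftable (hA : IsEGCM A) : (coxeterMatrix A).IsLiftable (simpleReflection hA) := by
  intro i j
  rcases eq_or_ne i j with rfl | hij
  · rw [CoxeterMatrix.diagonal, pow_one]
    ext1 v
    exact Module.involutive_reflection (two_form_self hA i) v
  have hM : coxeterMatrix A i j = bondOrder (A i j * A j i) := by
    simp [coxeterMatrix, hij]
  rw [hM]
  by_cases h0 : bondOrder (A i j * A j i) = 0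
  · rw [h0, pow_zero]
  obtain ⟨h2, hc⟩ := bondOrder_spec h0
  generalize bondOrder (A i j * A j i) = m at h2 hc
  have hf : ∀ k l : ι, ((2 : ℝ) • form A (simpleRoot k)) (simpleRoot l) = A k l := by
    intro k l
    simp [form_simpleRoot]
    ring
  rcases h2.eq_or_lt with rfl | h3
  · have hz : A i j = 0 := by
      by_contra hne
      have : A i j * A j i = 0 := by simpa using hc
      exact mul_ne_zero hne (hA.ne_zero i j hne) this
    have hz' : A j i = 0 := by
      by_contra hne
      exact hA.ne_zero j i hne hz
    ext1 v
    have hzf : form A (simpleRoot i) (simpleRoot j) = 0 := by rw [form_simpleRoot, hz]; simp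
    have hzf' : form A (simpleRoot j) (simpleRoot i) = 0 := by rw [form_simpleRoot, hz']; simp
    have hd : ∀ k, form A (simpleRoot k) (simpleRoot k) = 1 := by
      intro k; rw [form_simpleRoot, hA.diag]; norm_num
    simp only [pow_two, LinearEquiv.mul_apply, simpleReflection_apply, map_sub, map_smul, hzf, hzf',
      hd, LinearEquiv.coe_one, id_eq]
    module
  · have hm0 : (m : ℝ) ≠ 0 := by positivity
    have hsin : Real.sin (2 * Real.pi / m) ≠ 0 := by
      apply ne_of_gt
      apply Real.sin_pos_of_pos_of_lt_pi
      · have := Real.pi_pos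
        positivity
      · have h3' : (2 : ℝ) < m := by exact_mod_cast h3
        rw [div_lt_iff₀ (by linarith)]
        nlinarith [Real.pi_pos]
    have ht : 2 * Real.cos (2 * Real.pi / m) =
        ((2 : ℝ) • form A (simpleRoot i)) (simpleRoot j) *
          ((2 : ℝ) • form A (simpleRoot j)) (simpleRoot i) - 2 := by
      rw [hf, hf, hc, mul_div_assoc, Real.cos_two_mul]
      ring
    have hS : ∀ k : ℤ, (Polynomial.Chebyshev.S ℝ k).eval (2 * Real.cos (2 * Real.pi / m)) =
        Real.sin ((k + 1) * (2 * Real.pi / m)) / Real.sin (2 * Real.pi / m) := by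
      intro k
      rw [eq_div_iff hsin]
      exact Polynomial.Chebyshev.S_two_mul_real_cos _ _
    ext1 v
    refine (Module.reflection_mul_reflection_pow_apply (two_form_self hA i) (two_form_self hA j)
      m v _ ht).trans ?_
    obtain ⟨k, hk | hk⟩ := m.even_or_odd'
    · have e1 : ((m : ℤ) - 2) / 2 = k - 1 := by omega
      have hz : (Polynomial.Chebyshev.S ℝ (k - 1 : ℤ)).eval
          (2 * Real.cos (2 * Real.pi / m)) = 0 := by
        have : (((k - 1 : ℤ) : ℝ) + 1) * (2 * Real.pi / m) = Real.pi := by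
          have hk' : (m : ℝ) = 2 * k := by exact_mod_cast hk
          push_cast
          field_simp
          rw [hk']
          ring
        rw [hS, this, Real.sin_pi, zero_div]
      have e2 : ((m : ℤ) - 1) / 2 = k - 1 := by omega
      rw [e1, e2, hz]
      simp
    · have e1 : ((m : ℤ) - 1) / 2 = k := by omega
      have e2 : ((m : ℤ) - 3) / 2 = k - 1 := by omega
      have e3 : (m : ℤ) / 2 = k := by omega
      have e4 : ((m : ℤ) - 2) / 2 = k - 1 := by omega
      have hz : (Polynomial.Chebyshev.S ℝ (k : ℤ)).eval (2 * Real.cos (2 * Real.pi / m)) +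
          (Polynomial.Chebyshev.S ℝ (k - 1 : ℤ)).eval (2 * Real.cos (2 * Real.pi / m)) = 0 := by
        have hk' : (m : ℝ) = 2 * k + 1 := by exact_mod_cast hk
        have : (((k : ℤ) : ℝ) + 1) * (2 * Real.pi / m) =
            2 * Real.pi - (((k - 1 : ℤ) : ℝ) + 1) * (2 * Real.pi / m) := by
          push_cast
          field_simp
          rw [hk']
          ring
        rw [hS, hS, this, Real.sin_two_pi_sub]
        ring
      rw [e1, e2, e3, e4, hz]
      simp

/-- The geometric representation `σ : W → GL(V)`, with `σ (s_i) = S_i`. -/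
noncomputable def geomRep (hA : IsEGCM A) : W A →* ((ι → ℝ) ≃ₗ[ℝ] (ι → ℝ)) :=
  (coxeterMatrix A).toCoxeterSystem.lift ⟨simpleReflection hA, isLiftable hA⟩

theorem geomRep_simple (hA : IsEGCM A) (i : ι) :
    geomRep hA ((coxeterMatrix A).simple i) = simpleReflection hA i := by
  rw [← CoxeterMatrix.toCoxeterSystem_simple]
  exact (coxeterMatrix A).toCoxeterSystem.lift_apply_simple (isLiftable hA) i

/-- The root system `Φ = {w.α_i}`. -/
def roots (hA : IsEGCM A) : Set (ι → ℝ) :=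
  {α | ∃ (w : W A) (i : ι), α = geomRep hA w (simpleRoot i)}

/-- The positive roots `Φ⁺`. -/
def posRoots (hA : IsEGCM A) : Set (ι → ℝ) :=
  {α | α ∈ roots hA ∧ ∀ i, 0 ≤ α i}

/-- `𝔖 (α) = {K α : K ∈ ℝ} ∩ Φ⁺`. -/
def posMultiples (hA : IsEGCM A) (α : ι → ℝ) : Set (ι → ℝ) :=
  Set.range (fun K : ℝ => K • α) ∩ posRoots hA

end Representation

section KacMoody

variable {ι : Type*} [Fintype ι] [DecidableEq ι]

/-- A (real) realization of the matrix `A`: a real vector space `𝔥` of dimension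
`n + nullity A` with linearly independent simple coroots `α_i^∨ ∈ 𝔥` and linearly independent
simple roots `α_i ∈ 𝔥^*` such that `α_j (α_i^∨) = a_ij`. -/
structure Realization (A : Matrix ι ι ℝ) (𝔥 : Type*) [AddCommGroup 𝔥] [Module ℝ 𝔥] where
  root : ι → Module.Dual ℝ 𝔥
  coroot : ι → 𝔥
  root_linearIndependent : LinearIndependent ℝ root
  coroot_linearIndependent : LinearIndependent ℝ coroot
  pairing : ∀ i j, root j (coroot i) = A i j
  finite : Module.Finite ℝ 𝔥
  finrank_eq : Module.finrank ℝ 𝔥 =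
    Fintype.card ι + Module.finrank ℝ (LinearMap.ker A.toLin')

namespace Realization

variable {A : Matrix ι ι ℝ} {𝔥 : Type*} [AddCommGroup 𝔥] [Module ℝ 𝔥]

theorem eval_coroot_root (R : Realization A 𝔥) (hA : IsEGCM A) (i : ι) :
    Module.Dual.eval ℝ 𝔥 (R.coroot i) (R.root i) = 2 := by
  simp [R.pairing, hA.diag]

/-- `R_i (v) = v - v (α_i^∨) α_i` on `𝔥^*`. -/
noncomputable def simpleReflection (R : Realization A 𝔥) (hA : IsEGCM A) (i : ι) :
    Module.Dual ℝ 𝔥 ≃ₗ[ℝ] Module.Dual ℝ 𝔥 :=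
  Module.reflection (R.eval_coroot_root hA i)

/-- The Kac--Moody Weyl group, generated by the `R_i` inside `GL(𝔥^*)`. -/
noncomputable def weylGroup (R : Realization A 𝔥) (hA : IsEGCM A) :
    Subgroup (Module.Dual ℝ 𝔥 ≃ₗ[ℝ] Module.Dual ℝ 𝔥) :=
  Subgroup.closure (Set.range (R.simpleReflection hA))

/-- The Kac--Moody real roots: the Weyl group translates of the simple roots. -/
def realRoots (R : Realization A 𝔥) (hA : IsEGCM A) : Set (Module.Dual ℝ 𝔥) :=
  {β | ∃ w ∈ R.weylGroup hA, ∃ i, β = w (R.root i)}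

end Realization

end KacMoody

end EGCM

/-! Proportional roots arise only from odd bonds in rank two. Suppose `s_i` is not a right descent
of `w ≠ 1`, and let `s_k` be one. Split off on the right of `w` an alternating word of length n in
`s_i`, `s_k`, leaving a shorter `w'` with neither as a descent. In the basis α_i, r α_k that makes
the pair symmetric, the word sends α_i to a vector whose coordinates are consecutive Chebyshev
values (`geomRep_alternatingWord`). Both are positive if n + 1 < m_ik. If n + 1 = m_ik, the image is
α_i for even m_ik and r α_k for odd m_ik; in the odd case r = 1 exactly when a_ik = a_ki. This is
`exists_descent`.

Induction on length gives the sign dichotomy for roots. It also gives `reachable_of_geomRep_eq`: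
when w.α_i = K α_j with K > 0, positive combinations cannot occur, so i and j are joined by an
ON-path and K is a product of ratios r along it. Without asymmetries K = 1. Conversely, ON-paths are
realized by group elements, and an asymmetric bond then puts two positive roots on one line
(`noAsymmetryFrom_of_encard`). Integrality rules out odd asymmetries, and Kac–Moody real roots are
an injective linear image of Φ. -/

namespace CoxeterSystem

/-! ### Rank two cosets in a Coxeter group -/

variable {B W : Type*} [Group W] {M : CoxeterMatrix B} (cs : CoxeterSystem M W)

/-- Right coset decomposition with respect to a rank two parabolic subgroup. -/
theorem exists_eq_mul_alternatingWord (w : W) (i k : B) (hi : ¬ cs.IsRightDescent w i) :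
    ∃ (w' : W) (n : ℕ), w = w' * cs.wordProd (alternatingWord i k n) ∧
      cs.length w = cs.length w' + n ∧ ¬ cs.IsRightDescent w' i ∧ ¬ cs.IsRightDescent w' k := by
  induction hl : cs.length w using Nat.strong_induction_on generalizing w i k with
  | _ l ih =>
    by_cases hk : cs.IsRightDescent w k
    · have hk1 := cs.isRightDescent_iff.1 hk
      -- The roles of `i` and `k` swap: `w * s_k` no longer has `k` as a descent.
      obtain ⟨w', n, h1, h2, h3, h4⟩ := ih (cs.length (w * cs.simple k)) (by omega)
        (w * cs.simple k) k i (cs.isRightDescent_iff_not_isRightDescent_mul.1 hk) rfl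
      refine ⟨w', n + 1, ?_, by omega, h4, h3⟩
      rw [alternatingWord_succ, wordProd_concat, ← mul_assoc, ← h1,
        simple_mul_simple_cancel_right]
    · exact ⟨w, 0, by simp [alternatingWord], by omega, hi, hk⟩

/-- The alternating part of a rank two decomposition is shorter than the longest element. -/
theorem lt_of_eq_mul_alternatingWord {w w' : W} {i k : B} {n : ℕ}
    (hi : ¬ cs.IsRightDescent w i) (hw : w = w' * cs.wordProd (alternatingWord i k n))
    (hl : cs.length w = cs.length w' + n) (hM : M i k ≠ 0) : n < M i k := by
  -- Appending `s_i` lengthens `w`, so the alternating word of n + 1 letters would be reduced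
  -- although n + 1 exceeds the bond order.
  by_contra! hn
  rw [M.symmetric] at hM hn
  apply cs.not_isReduced_alternatingWord k i hM (m := n + 1) (Nat.lt_succ_of_le hn)
  have h1 := cs.not_isRightDescent_iff.1 hi
  have h2 : w * cs.simple i = w' * cs.wordProd (alternatingWord k i (n + 1)) := by
    rw [alternatingWord_succ, wordProd_concat, ← mul_assoc, ← hw]
  have h3 := cs.length_mul_le w' (cs.wordProd (alternatingWord k i (n + 1)))
  have h4 := cs.length_wordProd_le (alternatingWord k i (n + 1))
  rw [length_alternatingWord] at h4
  rw [← h2] at h3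
  rw [IsReduced, length_alternatingWord]
  omega

end CoxeterSystem

namespace EGCM

/-! ### Chebyshev values and their signs -/

/-- The sequence `0, 1, t, t² - 1, …` of values at `t` of the rescaled Chebyshev polynomials of the
second kind. -/
def chebyshevSeq (t : ℝ) : ℕ → ℝ
  | 0 => 0
  | 1 => 1
  | n + 2 => t * chebyshevSeq t (n + 1) - chebyshevSeq t n

theorem chebyshevSeq_mul_sin (θ : ℝ) (n : ℕ) :
    chebyshevSeq (2 * Real.cos θ) n * Real.sin θ = Real.sin (n * θ) := by
  induction n using Nat.twoStepInduction with
  | zero => simp [chebyshevSeq]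
  | one => simp [chebyshevSeq]
  | more n h1 h2 =>
    have e1 : ((n + 2 : ℕ) : ℝ) * θ = (n + 1 : ℕ) * θ + θ := by push_cast; ring
    have e2 : (n : ℝ) * θ = (n + 1 : ℕ) * θ - θ := by push_cast; ring
    rw [chebyshevSeq, sub_mul, mul_assoc, h1, h2, e1, e2, Real.sin_add, Real.sin_sub]
    ring

theorem sin_pi_div_pos {m : ℕ} (hm : 2 ≤ m) : 0 < Real.sin (Real.pi / m) := by
  have h : (2 : ℝ) ≤ m := by exact_mod_cast hm
  apply Real.sin_pos_of_pos_of_lt_pi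
  · have := Real.pi_pos
    positivity
  · exact div_lt_self Real.pi_pos (by linarith)

theorem chebyshevSeq_cos_pos {m n : ℕ} (hm : 2 ≤ m) (h0 : 0 < n) (hn : n < m) :
    0 < chebyshevSeq (2 * Real.cos (Real.pi / m)) n := by
  have hm0 : (0 : ℝ) < m := by exact_mod_cast (by omega : 0 < m)
  have hn' : (n : ℝ) < m := by exact_mod_cast hn
  have hn0 : (0 : ℝ) < n := by exact_mod_cast h0
  have h := chebyshevSeq_mul_sin (Real.pi / m) n
  have hs : 0 < Real.sin (n * (Real.pi / m)) := by
    apply Real.sin_pos_of_pos_of_lt_pi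
    · have := Real.pi_pos
      positivity
    · rw [← mul_div_assoc, div_lt_iff₀ hm0, mul_comm]
      exact mul_lt_mul_of_pos_left hn' Real.pi_pos
  rw [← h] at hs
  exact pos_of_mul_pos_left hs (sin_pi_div_pos hm).le

theorem chebyshevSeq_cos_self {m : ℕ} (hm : 2 ≤ m) :
    chebyshevSeq (2 * Real.cos (Real.pi / m)) m = 0 := by
  have hm0 : (m : ℝ) ≠ 0 := by exact_mod_cast (by omega : m ≠ 0)
  have h := chebyshevSeq_mul_sin (Real.pi / m) m
  rw [mul_div_cancel₀ _ hm0, Real.sin_pi] at h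
  exact (mul_eq_zero.1 h).resolve_right (sin_pi_div_pos hm).ne'

theorem chebyshevSeq_cos_pred {m : ℕ} (hm : 2 ≤ m) :
    chebyshevSeq (2 * Real.cos (Real.pi / m)) (m - 1) = 1 := by
  have hm0 : (m : ℝ) ≠ 0 := by exact_mod_cast (by omega : m ≠ 0)
  have h := chebyshevSeq_mul_sin (Real.pi / m) (m - 1)
  have e : ((m - 1 : ℕ) : ℝ) * (Real.pi / m) = Real.pi - Real.pi / m := by
    rw [Nat.cast_sub (by omega), sub_mul, mul_div_cancel₀ _ hm0]
    simp
  rw [e, Real.sin_pi_sub] at h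
  exact mul_right_cancel₀ (sin_pi_div_pos hm).ne' (h.trans (one_mul _).symm)

/-- For t ≥ 2 the successive differences never decrease, and the first one is 1. -/
theorem chebyshevSeq_pos {t : ℝ} (ht : 2 ≤ t) {n : ℕ} (h0 : 0 < n) : 0 < chebyshevSeq t n := by
  have key : ∀ n, 0 ≤ chebyshevSeq t n ∧ chebyshevSeq t n + 1 ≤ chebyshevSeq t (n + 1) := by
    intro n
    induction n with
    | zero => simp [chebyshevSeq]
    | succ n ih =>
      refine ⟨by linarith, ?_⟩
      rw [chebyshevSeq]
      nlinarith
  obtain ⟨n, rfl⟩ := Nat.exists_eq_succ_of_ne_zero h0.ne'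
  linarith [key n]

/-! ### Pairs of nodes and simple roots -/

variable {ι : Type*} [DecidableEq ι] {A : Matrix ι ι ℝ}

theorem coxeterMatrix_apply (A : Matrix ι ι ℝ) {i k : ι} (h : i ≠ k) :
    coxeterMatrix A i k = bondOrder (A i k * A k i) := by
  simp [coxeterMatrix, h]

theorem two_le_coxeterMatrix (A : Matrix ι ι ℝ) {i k : ι} (h : i ≠ k)
    (h0 : coxeterMatrix A i k ≠ 0) : 2 ≤ coxeterMatrix A i k := by
  rw [coxeterMatrix_apply A h] at *
  exact (bondOrder_spec h0).1

theorem cos_pi_div_nonneg {m : ℕ} (hm : 2 ≤ m) : 0 ≤ Real.cos (Real.pi / m) := by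
  have h : (2 : ℝ) ≤ m := by exact_mod_cast hm
  have hp := Real.pi_pos
  apply Real.cos_nonneg_of_neg_pi_div_two_le_of_le
  · have : 0 ≤ Real.pi / m := by positivity
    linarith
  · exact div_le_div_of_nonneg_left hp.le two_pos h

/-- The entries of an E-GCM at a pair of nodes, written as a rescaling by `r` of a symmetric
pair `(-t, -t)`. -/
theorem exists_scaling (hA : IsEGCM A) {i k : ι} (hik : i ≠ k) :
    ∃ r t : ℝ, 0 < r ∧ A k i = -(r * t) ∧ A i k = -(t / r) ∧
      (coxeterMatrix A i k = 0 → 2 ≤ t) ∧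
      (coxeterMatrix A i k ≠ 0 → t = 2 * Real.cos (Real.pi / coxeterMatrix A i k)) := by
  have hM := coxeterMatrix_apply A hik
  have h1 := hA.nonpos i k hik
  have h2 := hA.nonpos k i hik.symm
  have hp : 0 ≤ A i k * A k i := mul_nonneg_of_nonpos_of_nonpos h1 h2
  obtain ⟨t, ht, ht2⟩ : ∃ t : ℝ, 0 ≤ t ∧ t * t = A i k * A k i :=
    ⟨√(A i k * A k i), Real.sqrt_nonneg _, Real.mul_self_sqrt hp⟩
  have hT : (coxeterMatrix A i k = 0 → 2 ≤ t) ∧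
      (coxeterMatrix A i k ≠ 0 → t = 2 * Real.cos (Real.pi / coxeterMatrix A i k)) := by
    rw [hM]
    constructor
    · intro h0
      rcases hA.prod i k hik with h | h
      · nlinarith
      · exfalso
        rw [bondOrder, dif_pos h] at h0
        have := (Nat.find_spec h).1
        omega
    · intro h0
      obtain ⟨h3, h4⟩ := bondOrder_spec h0
      have h5 := cos_pi_div_nonneg h3
      rw [← ht2] at h4 h5 ⊢
      refine (pow_left_inj₀ ht (by positivity) two_ne_zero).1 ?_
      rw [mul_pow]
      linarith
  by_cases hz : A i k = 0
  · have hz' : A k i = 0 := by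
      by_contra h
      exact hA.ne_zero _ _ h hz
    have ht0 : t = 0 := by simpa [hz] using ht2
    exact ⟨1, t, one_pos, by simp [hz', ht0], by simp [hz, ht0], hT⟩
  · have hlt : 0 < - A i k := by
      have := lt_of_le_of_ne h1 hz
      linarith
    have hz' := hA.ne_zero _ _ hz
    have ht0 : t ≠ 0 := by
      rintro rfl
      exact mul_ne_zero hz hz' (by simpa using ht2.symm)
    -- The second equation forces this r; the first then follows from t² = a_ik a_ki.
    refine ⟨t / (- A i k), t, div_pos (lt_of_le_of_ne ht ht0.symm) hlt, ?_, ?_, hT⟩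
    · field_simp
      nlinarith
    · field_simp

theorem simpleRoot_ne_zero (i : ι) : (simpleRoot i : ι → ℝ) ≠ 0 := by
  simp [simpleRoot]

/-- If a positive combination of two nonnegative vectors is a multiple of a simple root, then so
are both vectors. -/
theorem eq_smul_simpleRoot_of_add {u v : ι → ℝ} {x y K : ℝ} {j : ι} (hu : 0 ≤ u) (hv : 0 ≤ v)
    (hx : 0 < x) (hy : 0 < y) (h : x • u + y • v = K • simpleRoot j) :
    u = u j • simpleRoot j ∧ v = v j • simpleRoot j := by
  have key : ∀ l, l ≠ j → u l = 0 ∧ v l = 0 := by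
    intro l hl
    have h1 := congrFun h l
    simp only [Pi.add_apply, Pi.smul_apply, smul_eq_mul, simpleRoot, Pi.single_eq_of_ne hl,
      mul_zero] at h1
    have h2 := (add_eq_zero_iff_of_nonneg (mul_nonneg hx.le (hu l)) (mul_nonneg hy.le (hv l))).1 h1
    exact ⟨(mul_eq_zero.1 h2.1).resolve_left hx.ne', (mul_eq_zero.1 h2.2).resolve_left hy.ne'⟩
  constructor <;> ext l <;> by_cases hl : l = j
  · subst hl; simp [simpleRoot]
  · simp [simpleRoot, Pi.single_eq_of_ne hl, key l hl]
  · subst hl; simp [simpleRoot]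
  · simp [simpleRoot, Pi.single_eq_of_ne hl, key l hl]

/-- There is no odd asymmetry in the ON-connected component of `x`. -/
def NoAsymmetryFrom (A : Matrix ι ι ℝ) (x : ι) : Prop :=
  ∀ i j, (onGraph A).Reachable x i → OddNeighbors A i j → A i j = A j i

theorem NoAsymmetryFrom.of_reachable {x y : ι} (h : NoAsymmetryFrom A x)
    (hxy : (onGraph A).Reachable x y) : NoAsymmetryFrom A y :=
  fun i j hi => h i j (hxy.trans hi)

/-! ### Rank two action, descent and proportionality to simple roots -/

variable [Fintype ι] (hA : IsEGCM A)

theorem geomRep_simple_simpleRoot (i j : ι) :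
    geomRep hA ((coxeterMatrix A).simple i) (simpleRoot j) =
      simpleRoot j - A i j • simpleRoot i := by
  rw [geomRep_simple, simpleReflection_apply, form_simpleRoot]
  congr 2
  ring

theorem geomRep_mul_apply (u v : W A) (x : ι → ℝ) :
    geomRep hA (u * v) x = geomRep hA u (geomRep hA v x) := by
  rw [map_mul, LinearEquiv.mul_apply]

theorem geomRep_mul_simple_self (w : W A) (i : ι) :
    geomRep hA (w * (coxeterMatrix A).simple i) (simpleRoot i) =
      - geomRep hA w (simpleRoot i) := by
  rw [geomRep_mul_apply, geomRep_simple_simpleRoot, hA.diag, ← map_neg]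
  congr 1
  module

open CoxeterSystem in
-- On α_i and r α_k both off-diagonal entries become -t, so each new letter changes one coordinate
-- by the three-term recurrence.
theorem geomRep_alternatingWord {i k : ι} {r t : ℝ} (hr : r ≠ 0)
    (h1 : A k i = -(r * t)) (h2 : A i k = -(t / r)) (n : ℕ) :
    geomRep hA ((coxeterMatrix A).toCoxeterSystem.wordProd (alternatingWord i k n))
        (simpleRoot i) =
      if Even n then
        chebyshevSeq t (n + 1) • simpleRoot i + (chebyshevSeq t n * r) • simpleRoot k
      else
        chebyshevSeq t n • simpleRoot i + (chebyshevSeq t (n + 1) * r) • simpleRoot k := by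
  induction n with
  | zero => simp [alternatingWord, chebyshevSeq]
  | succ n ih =>
    rw [alternatingWord_succ', wordProd_cons, geomRep_mul_apply, ih,
      CoxeterMatrix.toCoxeterSystem_simple]
    by_cases hn : Even n
    · have hn' : ¬ Even (n + 1) := by simpa [parity_simps] using hn
      rw [if_pos hn, if_pos hn, if_neg hn', map_add, map_smul, map_smul,
        geomRep_simple_simpleRoot, geomRep_simple_simpleRoot, hA.diag, h1, chebyshevSeq]
      module
    · have hn' : Even (n + 1) := by simpa [parity_simps] using hn
      rw [if_neg hn, if_neg hn, if_pos hn', map_add, map_smul, map_smul,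
        geomRep_simple_simpleRoot, geomRep_simple_simpleRoot, hA.diag, h2, chebyshevSeq]
      match_scalars <;> field_simp
      ring

open CoxeterSystem in
theorem geomRep_alternatingWord_of_lt {i k : ι} (hik : i ≠ k) {n : ℕ} (h0 : 0 < n)
    (hn : coxeterMatrix A i k ≠ 0 → n + 1 < coxeterMatrix A i k) :
    ∃ x y : ℝ, 0 < x ∧ 0 < y ∧
      geomRep hA ((coxeterMatrix A).toCoxeterSystem.wordProd (alternatingWord i k n))
        (simpleRoot i) = x • simpleRoot i + y • simpleRoot k := by
  obtain ⟨r, t, hr, h1, h2, h3, h4⟩ := exists_scaling hA hik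
  have hq : ∀ l, 0 < l → l ≤ n + 1 → 0 < chebyshevSeq t l := by
    intro l hl hln
    by_cases hM : coxeterMatrix A i k = 0
    · exact chebyshevSeq_pos (h3 hM) hl
    · rw [h4 hM]
      exact chebyshevSeq_cos_pos (two_le_coxeterMatrix A hik hM) hl (hln.trans_lt (hn hM))
  have ha := hq n h0 (by omega)
  have hb := hq (n + 1) (by omega) le_rfl
  rw [geomRep_alternatingWord hA hr.ne' h1 h2]
  split_ifs
  · exact ⟨_, _, hb, mul_pos ha hr, rfl⟩
  · exact ⟨_, _, ha, mul_pos hb hr, rfl⟩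

open CoxeterSystem in
-- At length m - 1 the coefficients are the Chebyshev values with indices m - 1 and m, namely 1 and
-- 0; parity decides which simple root survives.
theorem geomRep_alternatingWord_of_even {i k : ι} (hik : i ≠ k) {n : ℕ}
    (hn : n + 1 = coxeterMatrix A i k) (he : Even (coxeterMatrix A i k)) :
    geomRep hA ((coxeterMatrix A).toCoxeterSystem.wordProd (alternatingWord i k n))
      (simpleRoot i) = simpleRoot i := by
  obtain ⟨r, t, hr, h1, h2, h3, h4⟩ := exists_scaling hA hik
  have hM : coxeterMatrix A i k ≠ 0 := by omega
  have h5 := two_le_coxeterMatrix A hik hM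
  have hn' : ¬ Even n := by
    rw [← hn] at he
    simpa [parity_simps] using he
  rw [geomRep_alternatingWord hA hr.ne' h1 h2, if_neg hn', h4 hM, hn, chebyshevSeq_cos_self h5]
  rw [show n = coxeterMatrix A i k - 1 by omega, chebyshevSeq_cos_pred h5]
  simp

open CoxeterSystem in
-- For odd m the other simple root survives, scaled by r. This is the only source of ratios other
-- than ±1.
theorem geomRep_alternatingWord_of_odd {i k : ι} (hik : OddNeighbors A i k) :
    ∃ r : ℝ, 0 < r ∧ (r = 1 ↔ A i k = A k i) ∧ ∀ n, n + 1 = coxeterMatrix A i k →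
      geomRep hA ((coxeterMatrix A).toCoxeterSystem.wordProd (alternatingWord i k n))
        (simpleRoot i) = r • simpleRoot k := by
  obtain ⟨hne, ho⟩ := hik
  obtain ⟨r, t, hr, h1, h2, h3, h4⟩ := exists_scaling hA hne
  have hM : coxeterMatrix A i k ≠ 0 := by
    rintro h
    simp [h] at ho
  have h5 := two_le_coxeterMatrix A hne hM
  refine ⟨r, hr, ?_, ?_⟩
  · have h6 : 3 ≤ coxeterMatrix A i k := by
      obtain ⟨l, hl⟩ := ho
      omega
    have ht : 0 < t := by
      have := chebyshevSeq_cos_pos (n := 2) h5 two_pos h6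
      rw [← h4 hM] at this
      simpa [chebyshevSeq] using this
    rw [h1, h2, neg_inj, div_eq_iff hr.ne']
    constructor
    · rintro rfl
      ring
    · intro h
      have h7 : t * (r ^ 2 - 1) = 0 := by linarith
      have h8 : (r - 1) * (r + 1) = 0 := by
        have := (mul_eq_zero.1 h7).resolve_left ht.ne'
        linarith
      have := (mul_eq_zero.1 h8).resolve_right (by positivity)
      linarith
  · intro n hn
    have hn' : Even n := by
      rw [← hn] at ho
      simpa [parity_simps] using ho
    rw [geomRep_alternatingWord hA hr.ne' h1 h2, if_pos hn', h4 hM, hn, chebyshevSeq_cos_self h5]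
    rw [show n = coxeterMatrix A i k - 1 by omega, chebyshevSeq_cos_pred h5]
    simp

/-- One step of the descent along a rank two parabolic subgroup: `w.α_i` is either a positive
combination of two images of simple roots under a shorter element, or a multiple of one of them. -/
theorem exists_descent (w : W A) (hw : w ≠ 1) (i : ι)
    (hi : ¬ (coxeterMatrix A).toCoxeterSystem.IsRightDescent w i) :
    ∃ (k : ι) (w' : W A), i ≠ k ∧
      (coxeterMatrix A).toCoxeterSystem.length w' < (coxeterMatrix A).toCoxeterSystem.length w ∧
      ¬ (coxeterMatrix A).toCoxeterSystem.IsRightDescent w' i ∧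
      ¬ (coxeterMatrix A).toCoxeterSystem.IsRightDescent w' k ∧
      ((∃ x y : ℝ, 0 < x ∧ 0 < y ∧ geomRep hA w (simpleRoot i) =
          x • geomRep hA w' (simpleRoot i) + y • geomRep hA w' (simpleRoot k)) ∨
        geomRep hA w (simpleRoot i) = geomRep hA w' (simpleRoot i) ∨
        (OddNeighbors A i k ∧ ∃ r : ℝ, 0 < r ∧ (r = 1 ↔ A i k = A k i) ∧
          geomRep hA w (simpleRoot i) = r • geomRep hA w' (simpleRoot k))) := by
  obtain ⟨k, hk⟩ := (coxeterMatrix A).toCoxeterSystem.exists_rightDescent_of_ne_one hw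
  have hik : i ≠ k := by
    rintro rfl
    exact hi hk
  obtain ⟨w', n, h1, h2, h3, h4⟩ :=
    (coxeterMatrix A).toCoxeterSystem.exists_eq_mul_alternatingWord w i k hi
  have hlt := (coxeterMatrix A).toCoxeterSystem.lt_of_eq_mul_alternatingWord hi h1 h2
  have hn : 0 < n := by
    rcases Nat.eq_zero_or_pos n with rfl | h
    · simp only [CoxeterSystem.alternatingWord, CoxeterSystem.wordProd_nil, mul_one] at h1
      exact absurd (h1 ▸ hk) h4
    · exact h
  refine ⟨k, w', hik, by omega, h3, h4, ?_⟩
  rw [h1, geomRep_mul_apply]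
  -- The entry 0 encodes ∞, so infinite bonds fall under the generic case.
  by_cases hM : coxeterMatrix A i k ≠ 0 → n + 1 < coxeterMatrix A i k
  · obtain ⟨x, y, hx, hy, h⟩ := geomRep_alternatingWord_of_lt hA hik hn hM
    exact Or.inl ⟨x, y, hx, hy, by rw [h, map_add, map_smul, map_smul]⟩
  · push Not at hM
    have hn1 : n + 1 = coxeterMatrix A i k := le_antisymm (hlt hM.1) hM.2
    rcases Nat.even_or_odd (coxeterMatrix A i k) with he | ho
    · exact Or.inr (Or.inl (by rw [geomRep_alternatingWord_of_even hA hik hn1 he]))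
    · obtain ⟨r, hr, hr1, h⟩ := geomRep_alternatingWord_of_odd hA ⟨hik, ho⟩
      exact Or.inr (Or.inr ⟨⟨hik, ho⟩, r, hr, hr1, by rw [h n hn1, map_smul]⟩)

/-- Every outcome of `exists_descent` is a nonnegative combination of images covered by induction on
length. -/
theorem geomRep_simpleRoot_nonneg (w : W A) (i : ι)
    (hi : ¬ (coxeterMatrix A).toCoxeterSystem.IsRightDescent w i) :
    0 ≤ geomRep hA w (simpleRoot i) := by
  induction hl : (coxeterMatrix A).toCoxeterSystem.length w using Nat.strong_induction_on
    generalizing w i with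
  | _ l ih =>
    subst hl
    by_cases hw : w = 1
    · rw [hw, map_one]
      exact Pi.single_nonneg.2 zero_le_one
    obtain ⟨k, w', -, hlt, h1, h2, h⟩ := exists_descent hA w hw i hi
    have hi' := ih _ hlt w' i h1 rfl
    have hk' := ih _ hlt w' k h2 rfl
    rcases h with ⟨x, y, hx, hy, h⟩ | h | ⟨-, r, hr, -, h⟩
    · rw [h]
      exact add_nonneg (smul_nonneg hx.le hi') (smul_nonneg hy.le hk')
    · rwa [h]
    · rw [h]
      exact smul_nonneg hr.le hk'

theorem geomRep_simpleRoot_nonpos (w : W A) (i : ι)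
    (hi : (coxeterMatrix A).toCoxeterSystem.IsRightDescent w i) :
    geomRep hA w (simpleRoot i) ≤ 0 := by
  have h := geomRep_simpleRoot_nonneg hA (w * (coxeterMatrix A).simple i) i
    (by simpa using (coxeterMatrix A).toCoxeterSystem.isRightDescent_iff_not_isRightDescent_mul.1 hi)
  rw [geomRep_mul_simple_self] at h
  exact neg_nonneg.1 h

theorem geomRep_simpleRoot_ne_zero (w : W A) (i : ι) : geomRep hA w (simpleRoot i) ≠ 0 :=
  (map_ne_zero_iff _ (geomRep hA w).injective).2 (simpleRoot_ne_zero i)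

theorem not_proportional {w : W A} {i k j : ι} (hik : i ≠ k) {a b : ℝ}
    (h1 : geomRep hA w (simpleRoot i) = a • simpleRoot j)
    (h2 : geomRep hA w (simpleRoot k) = b • simpleRoot j) : False := by
  have h3 : b • (simpleRoot i : ι → ℝ) = a • simpleRoot k := by
    apply (geomRep hA w).injective
    rw [map_smul, map_smul, h1, h2, smul_comm]
  have hb : b = 0 := by
    simpa [simpleRoot, Pi.single_eq_of_ne hik] using congrFun h3 i
  apply geomRep_simpleRoot_ne_zero hA w k
  rw [h2, hb, zero_smul]

/-- α_j spans an extreme ray of the nonnegative cone, so the descent can only keep `i` or cross an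
odd bond, and each crossing contributes its factor r to K. -/
theorem reachable_of_geomRep_eq (w : W A) (i j : ι) (K : ℝ) (hK : 0 < K)
    (h : geomRep hA w (simpleRoot i) = K • simpleRoot j) :
    (onGraph A).Reachable i j ∧ (NoAsymmetryFrom A i → K = 1) := by
  induction hl : (coxeterMatrix A).toCoxeterSystem.length w using Nat.strong_induction_on
    generalizing w i K with
  | _ l ih =>
    subst hl
    by_cases hw : w = 1
    · have h1 := congrFun h j
      rw [hw, map_one] at h1
      have hij : i = j := by
        by_contra hij
        simp [simpleRoot, Pi.single_eq_of_ne (Ne.symm hij), hK.ne] at h1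
      subst hij
      refine ⟨SimpleGraph.Reachable.refl _, fun _ => ?_⟩
      simpa [simpleRoot] using h1.symm
    have hi : ¬ (coxeterMatrix A).toCoxeterSystem.IsRightDescent w i := by
      intro hi
      have h1 := geomRep_simpleRoot_nonpos hA w i hi j
      rw [h] at h1
      simp [simpleRoot] at h1
      linarith
    obtain ⟨k, w', hik, hlt, h1, h2, h'⟩ := exists_descent hA w hw i hi
    rcases h' with ⟨x, y, hx, hy, h'⟩ | h' | ⟨ho, r, hr, hr1, h'⟩
    · obtain ⟨h3, h4⟩ := eq_smul_simpleRoot_of_add (geomRep_simpleRoot_nonneg hA w' i h1)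
        (geomRep_simpleRoot_nonneg hA w' k h2) hx hy (h'.symm.trans h)
      -- Both images would lie on the line of α_j, against injectivity of the action.
      exact (not_proportional hA hik h3 h4).elim
    · exact ih _ hlt w' i K hK (h'.symm.trans h) rfl
    · have hadj : (onGraph A).Reachable i k := SimpleGraph.Adj.reachable (G := onGraph A) ho
      have h3 : geomRep hA w' (simpleRoot k) = (r⁻¹ * K) • simpleRoot j := by
        rw [mul_smul, ← h, h', inv_smul_smul₀ hr.ne']
      obtain ⟨h4, h5⟩ := ih _ hlt w' k (r⁻¹ * K) (by positivity) h3 rfl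
      refine ⟨hadj.trans h4, fun hN => ?_⟩
      have h6 := h5 (hN.of_reachable hadj)
      rw [hr1.2 (hN i k (SimpleGraph.Reachable.refl _) ho)] at h6
      simpa using h6

end EGCM

namespace EGCM

/-! ### Counting the positive multiples of a root -/

variable {ι : Type*} [DecidableEq ι] {A : Matrix ι ι ℝ} [Fintype ι] (hA : IsEGCM A)

theorem reachable_and_abs_eq_one (w : W A) (i j : ι) (K : ℝ)
    (h : geomRep hA w (simpleRoot i) = K • simpleRoot j) :
    (onGraph A).Reachable i j ∧ (NoAsymmetryFrom A i → |K| = 1) := by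
  rcases lt_trichotomy K 0 with hK | rfl | hK
  · have h1 : geomRep hA (w * (coxeterMatrix A).simple i) (simpleRoot i) =
        (-K) • simpleRoot j := by
      rw [geomRep_mul_simple_self, h, neg_smul]
    rw [abs_of_neg hK]
    exact reachable_of_geomRep_eq hA _ i j _ (neg_pos.2 hK) h1
  · rw [zero_smul] at h
    exact absurd h (geomRep_simpleRoot_ne_zero hA w i)
  · rw [abs_of_pos hK]
    exact reachable_of_geomRep_eq hA w i j K hK h

theorem neg_mem_roots {β : ι → ℝ} (h : β ∈ roots hA) : -β ∈ roots hA := by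
  obtain ⟨w, i, rfl⟩ := h
  exact ⟨w * (coxeterMatrix A).simple i, i, (geomRep_mul_simple_self hA w i).symm⟩

theorem ne_zero_of_mem_roots {β : ι → ℝ} (h : β ∈ roots hA) : β ≠ 0 := by
  obtain ⟨w, i, rfl⟩ := h
  exact geomRep_simpleRoot_ne_zero hA w i

theorem nonneg_or_nonpos_of_mem_roots {β : ι → ℝ} (h : β ∈ roots hA) : 0 ≤ β ∨ β ≤ 0 := by
  obtain ⟨w, i, rfl⟩ := h
  by_cases hi : (coxeterMatrix A).toCoxeterSystem.IsRightDescent w i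
  · exact Or.inr (geomRep_simpleRoot_nonpos hA w i hi)
  · exact Or.inl (geomRep_simpleRoot_nonneg hA w i hi)

theorem geomRep_inv_apply_self (w : W A) (v : ι → ℝ) :
    geomRep hA w⁻¹ (geomRep hA w v) = v := by
  rw [← geomRep_mul_apply, inv_mul_cancel, map_one, LinearEquiv.coe_one, id]

theorem abs_eq_one_of_smul_mem_roots {x : ι} (hx : NoAsymmetryFrom A x) (w : W A) {K : ℝ}
    (h : K • geomRep hA w (simpleRoot x) ∈ roots hA) : |K| = 1 := by
  obtain ⟨u, i, hu⟩ := h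
  have h1 : geomRep hA (w⁻¹ * u) (simpleRoot i) = K • simpleRoot x := by
    rw [geomRep_mul_apply, ← hu, map_smul, geomRep_inv_apply_self]
  obtain ⟨h2, h3⟩ := reachable_and_abs_eq_one hA _ i x K h1
  exact h3 (hx.of_reachable h2.symm)

theorem smul_mem_roots_iff {x : ι} (hx : NoAsymmetryFrom A x) (w : W A) (K : ℝ) :
    K • geomRep hA w (simpleRoot x) ∈ roots hA ↔ K = 1 ∨ K = -1 := by
  constructor
  · intro h
    exact eq_or_eq_neg_of_abs_eq (abs_eq_one_of_smul_mem_roots hA hx w h)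
  · rintro (rfl | rfl)
    · rw [one_smul]
      exact ⟨w, x, rfl⟩
    · rw [neg_one_smul]
      exact neg_mem_roots hA ⟨w, x, rfl⟩

theorem exists_geomRep_eq_of_reachable {i j : ι} (h : (onGraph A).Reachable i j) :
    ∃ (w : W A) (c : ℝ), 0 < c ∧ geomRep hA w (simpleRoot i) = c • simpleRoot j := by
  obtain ⟨p⟩ := h
  induction p with
  | nil => exact ⟨1, 1, one_pos, by simp⟩
  | cons hadj _ ih =>
    obtain ⟨w, c, hc, h⟩ := ih
    obtain ⟨r, hr, -, h'⟩ := geomRep_alternatingWord_of_odd hA hadj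
    specialize h' _ (Nat.sub_add_cancel hadj.2.pos)
    generalize (coxeterMatrix A).toCoxeterSystem.wordProd _ = v at h'
    exact ⟨w * v, r * c, mul_pos hr hc, by rw [geomRep_mul_apply, h', map_smul, h, smul_smul]⟩

/-- A root or its negative is positive; keeping |K| lets two scalings be compared without tracking
signs. -/
theorem exists_mem_posMultiples {α : ι → ℝ} {K : ℝ} (h : K • α ∈ roots hA) :
    ∃ L : ℝ, |L| = |K| ∧ L • α ∈ posMultiples hA α := by
  rcases nonneg_or_nonpos_of_mem_roots hA h with h0 | h0
  · exact ⟨K, rfl, ⟨K, rfl⟩, h, h0⟩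
  · refine ⟨-K, abs_neg K, ⟨-K, rfl⟩, ?_⟩
    rw [neg_smul]
    exact ⟨neg_mem_roots hA h, neg_nonneg.2 h0⟩

theorem encard_posMultiples_eq_one {x : ι} (hx : NoAsymmetryFrom A x) (w : W A) :
    (posMultiples hA (geomRep hA w (simpleRoot x))).encard = 1 := by
  have hroot : (1 : ℝ) • geomRep hA w (simpleRoot x) ∈ roots hA :=
    (smul_mem_roots_iff hA hx w 1).2 (Or.inl rfl)
  obtain ⟨L, -, hL⟩ := exists_mem_posMultiples hA hroot
  have hpm : ∀ β : ι → ℝ, β ∈ posRoots hA → -β ∉ posRoots hA := by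
    intro β h h'
    apply ne_zero_of_mem_roots hA h.1
    exact le_antisymm (neg_nonneg.1 (show 0 ≤ -β from h'.2)) h.2
  refine Set.encard_eq_one.2 ⟨_, Set.eq_singleton_iff_unique_mem.2 ⟨hL, ?_⟩⟩
  rintro _ ⟨⟨K, rfl⟩, hK⟩
  -- Opposite signs would make both a vector and its negative positive roots.
  rcases (smul_mem_roots_iff hA hx w K).1 hK.1 with rfl | rfl <;>
  rcases (smul_mem_roots_iff hA hx w L).1 hL.2.1 with rfl | rfl
  · rfl
  · exact absurd hL.2 (by simpa using hpm _ hK)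
  · exact absurd hK (by simpa using hpm _ hL.2)
  · rfl

/-- With u.α_x = c α_i and v.α_i = r α_j across an odd bond, c⁻¹ and r⁻¹c⁻¹ times w.α_x are both
roots. Uniqueness of the positive multiple forces r = 1. -/
theorem noAsymmetryFrom_of_encard {x : ι} {w : W A}
    (h : (posMultiples hA (geomRep hA w (simpleRoot x))).encard = 1) : NoAsymmetryFrom A x := by
  intro i j hi hij
  obtain ⟨u, c, hc, hu⟩ := exists_geomRep_eq_of_reachable hA hi
  obtain ⟨r, hr, hr1, hv⟩ := geomRep_alternatingWord_of_odd hA hij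
  specialize hv _ (Nat.sub_add_cancel hij.2.pos)
  generalize (coxeterMatrix A).toCoxeterSystem.wordProd _ = v at hv
  rw [← hr1]
  have h1 : geomRep hA (w * u⁻¹) (simpleRoot i) = c⁻¹ • geomRep hA w (simpleRoot x) := by
    rw [geomRep_mul_apply, ← map_smul]
    congr 1
    rw [← geomRep_inv_apply_self hA u (simpleRoot x), hu, map_smul, inv_smul_smul₀ hc.ne']
  have h2 : geomRep hA (w * u⁻¹ * v⁻¹) (simpleRoot j) =
      (r⁻¹ * c⁻¹) • geomRep hA w (simpleRoot x) := by
    rw [mul_smul, ← h1, geomRep_mul_apply, ← map_smul]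
    congr 1
    rw [← geomRep_inv_apply_self hA v (simpleRoot i), hv, map_smul, inv_smul_smul₀ hr.ne']
  obtain ⟨K, hK, hK'⟩ := exists_mem_posMultiples hA ⟨w * u⁻¹, i, h1.symm⟩
  obtain ⟨L, hL, hL'⟩ := exists_mem_posMultiples hA ⟨w * u⁻¹ * v⁻¹, j, h2.symm⟩
  have h3 := smul_left_injective ℝ (geomRep_simpleRoot_ne_zero hA w x)
    (Set.encard_le_one_iff.1 h.le _ _ hK' hL')
  rw [← h3, hK, abs_of_pos (by positivity), abs_of_pos (by positivity)] at hL
  field_simp at hL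
  exact hL

theorem encard_posMultiples_eq_one_iff (x : ι) (w : W A) :
    (posMultiples hA (geomRep hA w (simpleRoot x))).encard = 1 ↔ NoAsymmetryFrom A x :=
  ⟨noAsymmetryFrom_of_encard hA, fun h => encard_posMultiples_eq_one hA h w⟩

omit [Fintype ι] in
theorem not_hasOddAsymmetry_iff : ¬ HasOddAsymmetry A ↔ ∀ x, NoAsymmetryFrom A x := by
  constructor
  · intro h x i j _ hij
    by_contra hne
    exact h ⟨i, j, hij, hne⟩
  · rintro h ⟨i, j, hij, hne⟩
    exact hne (h i i j (SimpleGraph.Reachable.refl _) hij)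

omit [Fintype ι] in
theorem oddNeighbors_componentMatrix {C : (onGraph A).ConnectedComponent} (i j : C.supp) :
    OddNeighbors (componentMatrix A C) i j ↔ OddNeighbors A i j := by
  unfold OddNeighbors
  rw [← Subtype.coe_ne_coe]
  refine and_congr_right fun h => ?_
  rw [coxeterMatrix_apply _ h, coxeterMatrix_apply _ (Subtype.coe_ne_coe.1 h)]
  rfl

omit [Fintype ι] in
-- A component is closed under odd neighbors, and the order of a bond depends only on its two
-- entries.
theorem not_hasOddAsymmetry_componentMatrix_iff {C : (onGraph A).ConnectedComponent} {x : ι}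
    (hx : x ∈ C.supp) : ¬ HasOddAsymmetry (componentMatrix A C) ↔ NoAsymmetryFrom A x := by
  have hmem : ∀ i, (onGraph A).Reachable x i ↔ i ∈ C.supp := by
    intro i
    rw [SimpleGraph.ConnectedComponent.mem_supp_iff] at hx ⊢
    rw [← hx, eq_comm, SimpleGraph.ConnectedComponent.eq]
  constructor
  · intro h i j hi hij
    by_contra hne
    have hj := hi.trans (SimpleGraph.Adj.reachable (G := onGraph A) hij)
    exact h ⟨⟨i, (hmem i).1 hi⟩, ⟨j, (hmem j).1 hj⟩, (oddNeighbors_componentMatrix _ _).2 hij, hne⟩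
  · rintro h ⟨i, j, hij, hne⟩
    exact hne (h i j ((hmem i).2 i.2) ((oddNeighbors_componentMatrix i j).1 hij))

omit [Fintype ι] in
/-- An integral E-GCM has no odd asymmetries: odd bonds have order `3`, with both entries `-1`. -/
theorem not_hasOddAsymmetry_of_int (hA : IsEGCM A) (hint : ∀ i j, ∃ z : ℤ, A i j = z) :
    ¬ HasOddAsymmetry A := by
  rintro ⟨i, j, ⟨hij, ho⟩, hne⟩
  rw [coxeterMatrix_apply A hij] at ho
  have h0 : bondOrder (A i j * A j i) ≠ 0 := by
    rintro h
    simp [h] at ho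
  obtain ⟨h2, hc⟩ := bondOrder_spec h0
  generalize bondOrder (A i j * A j i) = m at ho h2 hc
  have h3 : 3 ≤ m := by
    obtain ⟨l, hl⟩ := ho
    omega
  have hm : (3 : ℝ) ≤ m := by exact_mod_cast h3
  have hpi := Real.pi_pos
  have hlt : Real.pi / m < Real.pi / 2 := div_lt_div_of_pos_left hpi two_pos (by linarith)
  have hpos : 0 < Real.pi / m := by positivity
  have hcos : 0 < Real.cos (Real.pi / m) := Real.cos_pos_of_mem_Ioo ⟨by linarith, hlt⟩
  have hsin := sin_pi_div_pos h2
  have hsc := Real.sin_sq_add_cos_sq (Real.pi / m)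
  -- The cosine is injective on [0, π], so the product of the entries determines m.
  have hinj : ∀ l : ℕ, 2 ≤ l → Real.cos (Real.pi / m) = Real.cos (Real.pi / l) → m = l := by
    intro l hl h
    have hl' : (2 : ℝ) ≤ l := by exact_mod_cast hl
    have h4 := Real.injOn_cos ⟨hpos.le, by linarith⟩
      ⟨by positivity, div_le_self hpi.le (by linarith)⟩ h
    rw [div_eq_div_iff (by positivity) (by positivity)] at h4
    exact_mod_cast (mul_left_cancel₀ hpi.ne' h4).symm
  obtain ⟨a, ha⟩ := hint i j
  obtain ⟨b, hb⟩ := hint j i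
  have ha0 := hA.nonpos i j hij
  have hb0 := hA.nonpos j i hij.symm
  rw [ha, hb] at hc hne
  rw [ha] at ha0
  rw [hb] at hb0
  have ha0' : a ≤ 0 := by exact_mod_cast ha0
  have hb0' : b ≤ 0 := by exact_mod_cast hb0
  have hp1 : 0 < a * b := by
    have : (0 : ℝ) < a * b := by rw [hc]; positivity
    exact_mod_cast this
  have hp4 : a * b < 4 := by
    have : (a * b : ℝ) < 4 := by rw [hc]; nlinarith
    exact_mod_cast this
  -- Products 2 and 3 give m = 4 and m = 6, which are even; product 1 forces equal integers.
  obtain h | h | h : a * b = 1 ∨ a * b = 2 ∨ a * b = 3 := by omega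
  · rcases Int.mul_eq_one_iff_eq_one_or_neg_one.1 h with ⟨rfl, rfl⟩ | ⟨rfl, rfl⟩ <;> simp at hne
  · have h' : (a * b : ℝ) = 2 := by exact_mod_cast h
    have h4 : m = 4 := by
      apply hinj 4 (by norm_num)
      rw [Nat.cast_ofNat, Real.cos_pi_div_four]
      refine (pow_left_inj₀ hcos.le (by positivity) two_ne_zero).1 ?_
      rw [div_pow, Real.sq_sqrt (by norm_num)]
      linarith
    subst h4
    exact absurd ho (by decide)
  · have h' : (a * b : ℝ) = 3 := by exact_mod_cast h
    have h4 : m = 6 := by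
      apply hinj 6 (by norm_num)
      rw [Nat.cast_ofNat, Real.cos_pi_div_six]
      refine (pow_left_inj₀ hcos.le (by positivity) two_ne_zero).1 ?_
      rw [div_pow, Real.sq_sqrt (by norm_num)]
      linarith
    subst h4
    exact absurd ho (by decide)

/-! ### Transfer to Kac–Moody real roots -/

namespace Realization

variable {𝔥 : Type*} [AddCommGroup 𝔥] [Module ℝ 𝔥] (R : Realization A 𝔥)

/-- The embedding of `V` into `𝔥^*` sending simple roots to simple roots. -/
noncomputable def rootMap : (ι → ℝ) →ₗ[ℝ] Module.Dual ℝ 𝔥 :=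
  Fintype.linearCombination ℝ R.root

theorem rootMap_injective : Function.Injective R.rootMap :=
  R.root_linearIndependent.fintypeLinearCombination_injective

theorem rootMap_simpleRoot (i : ι) : R.rootMap (EGCM.simpleRoot i) = R.root i := by
  simp [rootMap, EGCM.simpleRoot]

theorem simpleReflection_rootMap (i : ι) (v : ι → ℝ) :
    R.simpleReflection hA i (R.rootMap v) =
      R.rootMap (geomRep hA ((coxeterMatrix A).simple i) v) := by
  suffices h : (R.simpleReflection hA i).toLinearMap ∘ₗ R.rootMap =
      R.rootMap ∘ₗ (geomRep hA ((coxeterMatrix A).simple i)).toLinearMap from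
    LinearMap.congr_fun h v
  refine LinearMap.pi_ext' fun j => LinearMap.ext_ring ?_
  change R.simpleReflection hA i (R.rootMap (EGCM.simpleRoot j)) =
    R.rootMap (geomRep hA ((coxeterMatrix A).simple i) (EGCM.simpleRoot j))
  rw [geomRep_simple_simpleRoot, map_sub, map_smul, rootMap_simpleRoot, rootMap_simpleRoot,
    Realization.simpleReflection, Module.reflection_apply, Module.Dual.eval_apply, R.pairing]

/-- Only the action on the span of the simple roots matters for orbits, so no isomorphism between
the two groups is needed. -/
theorem exists_geomRep_of_mem_weylGroup {g : Module.Dual ℝ 𝔥 ≃ₗ[ℝ] Module.Dual ℝ 𝔥}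
    (hg : g ∈ R.weylGroup hA) :
    ∃ w : W A, ∀ v, g (R.rootMap v) = R.rootMap (geomRep hA w v) := by
  induction hg using Subgroup.closure_induction with
  | mem _ h =>
    obtain ⟨i, rfl⟩ := h
    exact ⟨_, R.simpleReflection_rootMap hA i⟩
  | one => exact ⟨1, fun v => by simp⟩
  | mul g h _ _ hg hh =>
    obtain ⟨u, hu⟩ := hg
    obtain ⟨w, hw⟩ := hh
    exact ⟨u * w, fun v => by rw [LinearEquiv.mul_apply, hw, hu, geomRep_mul_apply]⟩
  | inv g _ hg =>
    obtain ⟨u, hu⟩ := hg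
    refine ⟨u⁻¹, fun v => g.injective ?_⟩
    rw [hu, ← geomRep_mul_apply, mul_inv_cancel, map_one, LinearEquiv.coe_one, id,
      ← LinearEquiv.mul_apply, mul_inv_cancel, LinearEquiv.coe_one, id]

theorem exists_mem_weylGroup (w : W A) :
    ∃ g ∈ R.weylGroup hA, ∀ v, g (R.rootMap v) = R.rootMap (geomRep hA w v) := by
  induction w using (coxeterMatrix A).toCoxeterSystem.simple_induction_left with
  | one => exact ⟨1, one_mem _, fun v => by simp⟩
  | mul_simple_left w i ih =>
    obtain ⟨g, hg, h⟩ := ih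
    refine ⟨R.simpleReflection hA i * g,
      mul_mem (Subgroup.subset_closure ⟨i, rfl⟩) hg, fun v => ?_⟩
    rw [LinearEquiv.mul_apply, h, simpleReflection_rootMap, geomRep_mul_apply,
      CoxeterMatrix.toCoxeterSystem_simple]

theorem realRoots_eq_image : R.realRoots hA = R.rootMap '' roots hA := by
  ext β
  constructor
  · rintro ⟨g, hg, i, rfl⟩
    obtain ⟨w, hw⟩ := R.exists_geomRep_of_mem_weylGroup hA hg
    exact ⟨_, ⟨w, i, rfl⟩, by rw [← hw, rootMap_simpleRoot]⟩
  · rintro ⟨_, ⟨w, i, rfl⟩, rfl⟩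
    obtain ⟨g, hg, h⟩ := R.exists_mem_weylGroup hA w
    exact ⟨g, hg, i, by rw [← h, rootMap_simpleRoot]⟩

end Realization

end EGCM

theorem corollary3p7 {ι : Type*} [Fintype ι] [DecidableEq ι] (A : Matrix ι ι ℝ) (hA : IsEGCM A) :
    ((∀ α ∈ EGCM.roots hA, (EGCM.posMultiples hA α).encard = 1) ↔ ¬ EGCM.HasOddAsymmetry A) ∧
    (∀ C : (EGCM.onGraph A).ConnectedComponent,
      ((∃ x ∈ C.supp, ∃ w : EGCM.W A,
          (EGCM.posMultiples hA (EGCM.geomRep hA w (EGCM.simpleRoot x))).encard = 1) ↔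
        (∀ x ∈ C.supp, ∀ w : EGCM.W A,
          (EGCM.posMultiples hA (EGCM.geomRep hA w (EGCM.simpleRoot x))).encard = 1)) ∧
      ((∀ x ∈ C.supp, ∀ w : EGCM.W A,
          (EGCM.posMultiples hA (EGCM.geomRep hA w (EGCM.simpleRoot x))).encard = 1) ↔
        ¬ EGCM.HasOddAsymmetry (EGCM.componentMatrix A C))) ∧
    ((∀ i j, ∃ z : ℤ, A i j = z) →
      (∀ α ∈ EGCM.roots hA, ∀ K : ℝ, K • α ∈ EGCM.roots hA ↔ K = 1 ∨ K = -1) ∧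
      (∀ (𝔥 : Type*) [AddCommGroup 𝔥] [Module ℝ 𝔥] (R : EGCM.Realization A 𝔥),
        ∀ α ∈ R.realRoots hA, ∀ K : ℝ, K • α ∈ R.realRoots hA ↔ K = 1 ∨ K = -1)) := by
  refine ⟨?_, fun C => ?_, fun hint => ?_⟩
  · rw [EGCM.not_hasOddAsymmetry_iff]
    constructor
    · intro h x
      exact EGCM.noAsymmetryFrom_of_encard hA (h _ ⟨1, x, rfl⟩)
    · rintro h _ ⟨w, x, rfl⟩
      exact EGCM.encard_posMultiples_eq_one hA (h x) w
  -- The counting condition becomes one that does not involve `w` and is constant on the component.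
  · simp only [EGCM.encard_posMultiples_eq_one_iff]
    have hC := fun x hx => EGCM.not_hasOddAsymmetry_componentMatrix_iff (C := C) (x := x) hx
    obtain ⟨y, hy⟩ := C.nonempty_supp
    refine ⟨⟨?_, fun h => ⟨y, hy, 1, h y hy 1⟩⟩, fun h => (hC y hy).2 (h y hy 1),
      fun h x hx _ => (hC x hx).1 h⟩
    rintro ⟨x, hx, -, h⟩ z hz -
    exact (hC z hz).1 ((hC x hx).2 h)
  · have hno := EGCM.not_hasOddAsymmetry_iff.1 (EGCM.not_hasOddAsymmetry_of_int hA hint)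
    have hroots : ∀ α ∈ EGCM.roots hA, ∀ K : ℝ, K • α ∈ EGCM.roots hA ↔ K = 1 ∨ K = -1 := by
      rintro _ ⟨w, x, rfl⟩ K
      exact EGCM.smul_mem_roots_iff hA (hno x) w K
    refine ⟨hroots, fun 𝔥 _ _ R α hα K => ?_⟩
    rw [R.realRoots_eq_image] at hα ⊢
    obtain ⟨β, hβ, rfl⟩ := hα
    rw [← map_smul, R.rootMap_injective.mem_set_image]
    exact hroots β hβ K
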